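/- An instance of robust network design with linear cost consists of a finite undirected (simple) graph $G=(V,E)$, a finite set $\mathcal H$ of commodities with pairwise different node pairs $\{s(h),t(h)\}$, $s(h)\neq t(h)$, a nonempty polyhedral set $\mathcal D\subseteq\mathbb R_{\ge 0}^{\mathcal H}$ of demand vectors, and a cost vector $\lambda\in\mathbb R_{\ge 0}^{E}$. A capacity vector $u\in\mathbb R^{E}$ is feasible for dynamic fractional routing if for every $d\in\mathcal D$ there are flows $f^h$ of intensity $d_h$ from $s(h)$ to $t(h)$ in $G$ $(h\in\mathcal H)$ such that for each edge $e$ the total flow (of all commodities, in both directions) on $e$ is at most $u_e$. It is feasible for static fractional routing if there are fixed flows $x^h$ of intensity $1$ from $s(h)$ to $t(h)$ $(h\in\mathcal H)$ such that for every $d\in\mathcal D$ the scaled flows $d_h x^h$ satisfy these capacity constraints. Let $\mathrm{Lin}_{dyn-frac}$ and $\mathrm{Lin}_{stat-frac}$ be the optimal values (infima) of $\sum_{e\in E}\lambda_e u_e$ over the capacity vectors $u$ feasible for dynamic and for static fractional routing, respectively. Theorem. There are instances for which $\mathrm{Lin}_{stat-frac}/\mathrm{Lin}_{dyn-frac}$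 is $\Omega(\log n)$, where $n=|V|$. That is, there is a constant $c>0$ such that for every $N$ there are an $n\ge N$ and an instance on a graph with $n$ vertices for which both feasible sets are nonempty, $\mathrm{Lin}_{dyn-frac}>0$, and $$\frac{\mathrm{Lin}_{stat-frac}}{\mathrm{Lin}_{dyn-frac}}\ \ge\ c\,\log n .$$ -/

import Mathlib

/-- A polyhedral set in `ℝ^k`: the solution set of finitely many linear inequalities `A d ≤ b`. -/
def IsPolyhedral {k : ℕ} (D : Set (Fin k → ℝ)) : Prop :=
  ∃ (m : ℕ) (A : Matrix (Fin m) (Fin k) ℝ) (b : Fin m → ℝ), D = {d | A.mulVec d ≤ b}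

/-- `F a b` is the amount of flow sent through the edge `{a, b}` of the undirected graph `G` in the
direction from `a` to `b`; `IsFlow G s t r F` says that `F` is a (fractional) flow of intensity `r`
from `s` to `t` in `G`. -/
structure IsFlow {n : ℕ} (G : SimpleGraph (Fin n)) (s t : Fin n) (r : ℝ)
    (F : Fin n → Fin n → ℝ) : Prop where
  nonneg : ∀ a b, 0 ≤ F a b
  support : ∀ a b, ¬ G.Adj a b → F a b = 0
  conservation : ∀ v, ∑ w, F v w - ∑ w, F w v
    = r * ((if v = s then 1 else 0) - (if v = t then 1 else 0))

/-- The amount of an undirected edge's capacity that a flow uses: both directions add up. -/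
def edgeLoad {n : ℕ} (F : Fin n → Fin n → ℝ) : Sym2 (Fin n) → ℝ :=
  Sym2.lift ⟨fun a b => F a b + F b a, fun a b => add_comm (F a b) (F b a)⟩

/-- An instance of robust network design with linear cost on `n` vertices: an undirected graph,
finitely many commodities on different node pairs, a nonempty polyhedral set of nonnegative demand
vectors, and a nonnegative reservation cost for each edge. -/
structure RobustInstance (n : ℕ) where
  /-- the network -/
  G : SimpleGraph (Fin n)
  /-- the number of commodities -/
  k : ℕ
  /-- one endpoint of each commodity -/
  src : Fin k → Fin n
  /-- the other endpoint of each commodity -/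
  tgt : Fin k → Fin n
  src_ne_tgt : ∀ h, src h ≠ tgt h
  pairs_injective : Function.Injective (fun h => s(src h, tgt h))
  /-- the uncertainty set -/
  D : Set (Fin k → ℝ)
  D_polyhedral : IsPolyhedral D
  D_nonempty : D.Nonempty
  D_nonneg : ∀ d ∈ D, ∀ h, 0 ≤ d h
  /-- the cost of reserving one unit of capacity on each edge -/
  lam : G.edgeSet → ℝ
  lam_nonneg : ∀ e, 0 ≤ lam e

namespace RobustInstance

variable {n : ℕ} (I : RobustInstance n)

/-- Reservation vectors feasible for dynamic fractional routing: every demand vector has its own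
routing within the reserved capacities. -/
def dynCapacities : Set (I.G.edgeSet → ℝ) :=
  {u | ∀ d ∈ I.D, ∃ F : Fin I.k → Fin n → Fin n → ℝ,
    (∀ h, IsFlow I.G (I.src h) (I.tgt h) (d h) (F h)) ∧
    ∀ e : I.G.edgeSet, ∑ h, edgeLoad (F h) e ≤ u e}

/-- Reservation vectors feasible for static fractional routing: one fixed flow of value `1` per
commodity, scaled by the actual demand, serves all demand vectors. -/
def statCapacities : Set (I.G.edgeSet → ℝ) :=
  {u | ∃ X : Fin I.k → Fin n → Fin n → ℝ,
    (∀ h, IsFlow I.G (I.src h) (I.tgt h) 1 (X h)) ∧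
    ∀ d ∈ I.D, ∀ e : I.G.edgeSet, ∑ h, d h * edgeLoad (X h) e ≤ u e}

open Classical in
/-- The linear reservation cost of a reservation vector. -/
noncomputable def cost (u : I.G.edgeSet → ℝ) : ℝ := ∑ e, I.lam e * u e

/-- The optimal linear cost under dynamic fractional routing. Feasible costs are nonnegative, so
this is a genuine infimum unless no reservation vector is feasible, when the value is `0`. -/
noncomputable def linDyn : ℝ := sInf (I.cost '' I.dynCapacities)

/-- The optimal linear cost under static fractional routing (same convention). -/
noncomputable def linStat : ℝ := sInf (I.cost '' I.statCapacities)

end RobustInstance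

/-! The network is a hypercube of dimension `m = 6R` whose edges cost 1, with each vertex joined to
a hub by an edge of cost `R`. The extreme demands ask for one unit from every vertex of a ball of
radius `R` to the hub. The number of nodes is `2 * 2 ^ m + 1`, so `log n` has order `R`.

Dynamic routing knows the centre `v` of the ball. Each vertex sends its unit along random chains
moving away from `v` until distance `2R`, and only there to the hub. The spheres grow at least
geometrically up to that radius, so the flow thins out: each cube edge carries at most `1 / R`
(`sum_chainFlow_le`) and each hub edge at most `2 / 2 ^ R` (`sum_exitFlow_le`). These loads do not
depend on `v`, and the resulting capacities cost at most `5 * 2 ^ m` (`cost_hubCapacity_le`).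

Static routing must fix its flows before the ball is known, and the adversary may choose a different
ball for each edge. In the dual (`le_linStat`), the ball around an endpoint of each edge is charged.
A unit from `i` then pays either for a hub edge near `i` or for a walk of length `R` away from `i`,
hence at least `R`. The distance from `i` truncated at `R` is the dual certificate
(`hubPotential_sub_le`), and the total is `2 ^ m * R`.

The cost-free pendant nodes only record the coefficients of a convex combination of balls, so that
the hull is given by explicit linear constraints. -/

/-! ### Flows, potentials and edge loads. -/

/-- The conservation defects sum to zero over all nodes, so the one at `t` follows from the others.
This avoids any computation at the hub. -/
theorem IsFlow.of_conservation_ne {n : ℕ} {G : SimpleGraph (Fin n)} {s t : Fin n} {r : ℝ}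
    {F : Fin n → Fin n → ℝ} (hn : ∀ a b, 0 ≤ F a b) (hs : ∀ a b, ¬ G.Adj a b → F a b = 0)
    (hc : ∀ v, v ≠ t → ∑ w, F v w - ∑ w, F w v
      = r * ((if v = s then 1 else 0) - (if v = t then 1 else 0))) :
    IsFlow G s t r F := by
  refine ⟨hn, hs, fun v => ?_⟩
  by_cases hv : v = t
  · subst hv
    have h1 : ∑ x, (∑ w, F x w - ∑ w, F w x
        - r * ((if x = s then 1 else 0) - (if x = v then 1 else 0))) = 0 := by
      rw [Finset.sum_sub_distrib, Finset.sum_sub_distrib, Finset.sum_comm, sub_self,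
        ← Finset.mul_sum, Finset.sum_sub_distrib]
      simp
    rw [Finset.sum_eq_single v (fun x _ hx => by rw [hc x hx]; simp) (by simp)] at h1
    linarith
  · exact hc v hv

theorem IsFlow.sum_mul {n : ℕ} {G : SimpleGraph (Fin n)} {s t : Fin n} {ι : Type*} [Fintype ι]
    {c r : ι → ℝ} {F : ι → Fin n → Fin n → ℝ} (hc : ∀ j, 0 ≤ c j)
    (hF : ∀ j, IsFlow G s t (r j) (F j)) :
    IsFlow G s t (∑ j, c j * r j) (fun a b => ∑ j, c j * F j a b) := by
  refine ⟨fun a b => Finset.sum_nonneg fun j _ => mul_nonneg (hc j) ((hF j).nonneg a b),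
    fun a b h => Finset.sum_eq_zero fun j _ => by rw [(hF j).support a b h, mul_zero],
    fun v => ?_⟩
  rw [Finset.sum_comm, Finset.sum_comm (s := Finset.univ) (t := Finset.univ)
    (f := fun w j => c j * F j w v), ← Finset.sum_sub_distrib, Finset.sum_mul]
  refine Finset.sum_congr rfl fun j _ => ?_
  rw [← Finset.mul_sum, ← Finset.mul_sum, ← mul_sub, (hF j).conservation v, mul_assoc]

/-- Summation by parts against the conservation law. -/
theorem IsFlow.sum_mul_potential {n : ℕ} {G : SimpleGraph (Fin n)} {s t : Fin n} {r : ℝ}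
    {F : Fin n → Fin n → ℝ} (hF : IsFlow G s t r F) (φ : Fin n → ℝ) :
    ∑ a, ∑ b, F a b * (φ b - φ a) = r * (φ t - φ s) := by
  have h1 : ∑ v, φ v * (∑ w, F v w - ∑ w, F w v) = r * (φ s - φ t) := by
    simp_rw [hF.conservation]
    have : ∀ v, φ v * (r * ((if v = s then 1 else 0) - (if v = t then 1 else 0)))
        = r * ((if v = s then φ v else 0) - (if v = t then φ v else 0)) := by
      intro v; split_ifs <;> ring
    simp_rw [this]
    rw [← Finset.mul_sum, Finset.sum_sub_distrib]
    simp
  have h2 : ∑ a, ∑ b, F a b * (φ b - φ a) = - ∑ v, φ v * (∑ w, F v w - ∑ w, F w v) := by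
    simp_rw [mul_sub, Finset.sum_sub_distrib, Finset.mul_sum]
    rw [Finset.sum_comm (f := fun a b => F a b * φ b), neg_sub]
    congr 1 <;> exact Finset.sum_congr rfl fun _ _ => Finset.sum_congr rfl fun _ _ => mul_comm _ _
  rw [h2, h1]; ring

@[simp] theorem edgeLoad_mk {n : ℕ} (F : Fin n → Fin n → ℝ) (a b : Fin n) :
    edgeLoad F s(a, b) = F a b + F b a := rfl

theorem edgeLoad_nonneg {n : ℕ} {F : Fin n → Fin n → ℝ} (h : ∀ a b, 0 ≤ F a b)
    (e : Sym2 (Fin n)) : 0 ≤ edgeLoad F e := by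
  induction e using Sym2.ind with
  | _ a b => exact add_nonneg (h a b) (h b a)

theorem sum_edgeLoad {n : ℕ} (G : SimpleGraph (Fin n)) [Fintype G.edgeSet]
    {K : Fin n → Fin n → ℝ} (hK : ∀ a b, ¬ G.Adj a b → K a b = 0) :
    ∑ e : G.edgeSet, edgeLoad K e = ∑ a, ∑ b, K a b := by
  classical
  have h1 : ∑ e : G.edgeSet, edgeLoad K e = ∑ e ∈ G.edgeFinset, edgeLoad K e :=
    (Finset.sum_subtype _ (fun e => SimpleGraph.mem_edgeFinset) _).symm
  have h2 : ∑ a, ∑ b, K a b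
      = ∑ p ∈ (Finset.univ : Finset (Fin n × Fin n)).filter (fun p => G.Adj p.1 p.2),
          K p.1 p.2 := by
    rw [← Fintype.sum_prod_type', Finset.sum_filter]
    refine Finset.sum_congr rfl fun p _ => ?_
    split_ifs with h
    · rfl
    · exact hK _ _ h
  rw [h1, h2, ← Finset.sum_fiberwise_of_maps_to (t := G.edgeFinset) (g := fun p : Fin n × Fin n => s(p.1, p.2))
    (fun p hp => by simpa using hp)]
  refine Finset.sum_congr rfl fun e he => ?_
  induction e using Sym2.ind with
  | _ a b =>
    have hab : G.Adj a b := by simpa using he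
    have : (Finset.univ.filter (fun p : Fin n × Fin n => G.Adj p.1 p.2)).filter
        (fun p => s(p.1, p.2) = s(a, b)) = {(a, b), (b, a)} := by
      ext ⟨x, y⟩
      simp only [Finset.mem_filter, Finset.mem_univ, true_and, Sym2.eq_iff, Finset.mem_insert,
        Finset.mem_singleton, Prod.mk.injEq]
      constructor
      · exact fun h => h.2
      · rintro (⟨rfl, rfl⟩ | ⟨rfl, rfl⟩)
        · exact ⟨hab, Or.inl ⟨rfl, rfl⟩⟩
        · exact ⟨hab.symm, Or.inr ⟨rfl, rfl⟩⟩
    rw [this, Finset.sum_pair (by simpa using fun h => absurd h hab.ne)]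
    rfl

/-! ### Polyhedral sets. -/

theorem isPolyhedral_setOf_forall_le {k : ℕ} {ι : Type*} [Fintype ι]
    (f : ι → (Fin k → ℝ) →ₗ[ℝ] ℝ) (b : ι → ℝ) : IsPolyhedral {d | ∀ j, f j d ≤ b j} := by
  let e := Fintype.equivFin ι
  refine ⟨Fintype.card ι, LinearMap.toMatrix' (LinearMap.pi fun j => f (e.symm j)),
    fun j => b (e.symm j), ?_⟩
  ext d
  simp only [Set.mem_ofPred_eq, LinearMap.toMatrix'_mulVec, Pi.le_def, LinearMap.pi_apply]
  exact e.symm.forall_congr_right.symm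

theorem IsPolyhedral.inter {k : ℕ} {C D : Set (Fin k → ℝ)} (hC : IsPolyhedral C)
    (hD : IsPolyhedral D) : IsPolyhedral (C ∩ D) := by
  obtain ⟨m, A, b, rfl⟩ := hC
  obtain ⟨m', A', b', rfl⟩ := hD
  convert isPolyhedral_setOf_forall_le
    (Sum.elim (fun j => LinearMap.proj j ∘ₗ A.mulVecLin) (fun j => LinearMap.proj j ∘ₗ A'.mulVecLin))
    (Sum.elim b b') using 1
  ext d
  simp [Pi.le_def]

theorem isPolyhedral_setOf_forall_eq {k : ℕ} {ι : Type*} [Fintype ι]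
    (f : ι → (Fin k → ℝ) →ₗ[ℝ] ℝ) (b : ι → ℝ) : IsPolyhedral {d | ∀ j, f j d = b j} := by
  convert (isPolyhedral_setOf_forall_le f b).inter (isPolyhedral_setOf_forall_le (-f) (-b)) using 1
  ext d
  simp [le_antisymm_iff, forall_and]

/-! ### Dual lower bounds on the two optimal values. -/

namespace RobustInstance

variable {n : ℕ} (I : RobustInstance n)

theorem dynCapacities_nonneg {u : I.G.edgeSet → ℝ} (hu : u ∈ I.dynCapacities) (e : I.G.edgeSet) :
    0 ≤ u e := by
  obtain ⟨d, hd⟩ := I.D_nonempty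
  obtain ⟨F, hF, h⟩ := hu d hd
  exact (Finset.sum_nonneg fun i _ => edgeLoad_nonneg (hF i).nonneg _).trans (h e)

theorem linDyn_le_cost {u : I.G.edgeSet → ℝ} (hu : u ∈ I.dynCapacities) : I.linDyn ≤ I.cost u := by
  refine csInf_le ⟨0, ?_⟩ ⟨u, hu, rfl⟩
  rintro _ ⟨u', hu', rfl⟩
  exact Finset.sum_nonneg fun e _ => mul_nonneg (I.lam_nonneg e) (I.dynCapacities_nonneg hu' e)

/-- Weak duality: for flows whose loads, weighted edge by edge by `d`, respect the capacities, the
weighted potential differences bound the cost from below. -/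
theorem potential_le_cost {u : I.G.edgeSet → ℝ} {r : Fin I.k → ℝ} {F : Fin I.k → Fin n → Fin n → ℝ}
    (hF : ∀ h, IsFlow I.G (I.src h) (I.tgt h) (r h) (F h)) (d : I.G.edgeSet → Fin I.k → ℝ)
    (hu : ∀ e, ∑ h, d e h * edgeLoad (F h) e ≤ u e) (φ : Fin I.k → Fin n → ℝ)
    (hφ : ∀ h a b (hab : I.G.Adj a b), φ h b - φ h a ≤ I.lam ⟨s(a, b), hab⟩ * d ⟨s(a, b), hab⟩ h) :
    ∑ h, r h * (φ h (I.tgt h) - φ h (I.src h)) ≤ I.cost u := by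
  classical
  calc ∑ h, r h * (φ h (I.tgt h) - φ h (I.src h))
      = ∑ h, ∑ e : I.G.edgeSet, edgeLoad (fun a b => F h a b * (φ h b - φ h a)) e := by
        refine Finset.sum_congr rfl fun h _ => ?_
        rw [sum_edgeLoad I.G fun a b hab => by rw [(hF h).support a b hab, zero_mul],
          (hF h).sum_mul_potential]
    _ ≤ ∑ h, ∑ e : I.G.edgeSet, I.lam e * (d e h * edgeLoad (F h) e) := by
        refine Finset.sum_le_sum fun h _ => Finset.sum_le_sum fun e _ => ?_
        obtain ⟨e, he⟩ := e
        induction e using Sym2.ind with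
        | _ a b =>
          have h1 := mul_le_mul_of_nonneg_left (hφ h a b he) ((hF h).nonneg a b)
          have h2 := mul_le_mul_of_nonneg_left (hφ h b a he.symm) ((hF h).nonneg b a)
          have h3 : (⟨s(b, a), he.symm⟩ : I.G.edgeSet) = ⟨s(a, b), he⟩ := Subtype.ext Sym2.eq_swap
          rw [h3] at h2
          simp only [edgeLoad_mk]
          linarith
    _ = ∑ e : I.G.edgeSet, I.lam e * ∑ h, d e h * edgeLoad (F h) e := by
        rw [Finset.sum_comm]
        simp_rw [Finset.mul_sum]
    _ ≤ I.cost u := by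
        rw [cost]
        convert Finset.sum_le_sum fun e _ => mul_le_mul_of_nonneg_left (hu e) (I.lam_nonneg e)

/-- Since the unit flows are fixed, the capacity constraint of each edge may be tested with its own
demand vector. This freedom is the source of the gap. -/
theorem le_linStat (hne : I.statCapacities.Nonempty) (φ : Fin I.k → Fin n → ℝ)
    (hφ : ∀ e : I.G.edgeSet, ∃ d ∈ I.D, ∀ h a b, (e : Sym2 (Fin n)) = s(a, b) →
      φ h b - φ h a ≤ I.lam e * d h) :
    ∑ h, (φ h (I.tgt h) - φ h (I.src h)) ≤ I.linStat := by
  refine le_csInf (hne.image _) ?_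
  rintro _ ⟨u, ⟨X, hX, hu⟩, rfl⟩
  choose d hd hd' using hφ
  simpa using I.potential_le_cost hX d (fun e => hu _ (hd e) e) φ
    (fun h a b hab => hd' _ h a b rfl)

theorem le_linDyn (hne : I.dynCapacities.Nonempty) {d : Fin I.k → ℝ} (hd : d ∈ I.D)
    (φ : Fin I.k → Fin n → ℝ)
    (hφ : ∀ h a b (hab : I.G.Adj a b), φ h b - φ h a ≤ I.lam ⟨s(a, b), hab⟩) :
    ∑ h, d h * (φ h (I.tgt h) - φ h (I.src h)) ≤ I.linDyn := by
  refine le_csInf (hne.image _) ?_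
  rintro _ ⟨u, hu, rfl⟩
  obtain ⟨F, hF, hu⟩ := hu d hd
  exact I.potential_le_cost hF (fun _ _ => 1) (by simpa using hu) φ (by simpa using hφ)

end RobustInstance

open Finset

/-! ### Growth of binomial coefficients in the lower third. -/

theorem choose_mul_two_pow_le {m j b : ℕ} (hjb : j ≤ b) (hb : 3 * b ≤ m) :
    m.choose j * 2 ^ (b - j) ≤ m.choose b := by
  induction b, hjb using Nat.le_induction with
  | base => simp
  | succ b hjb ih =>
    have h1 : m.choose b * 2 ≤ m.choose (b + 1) := by
      have h2 := Nat.choose_succ_right_eq m b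
      have h3 : 2 * (b + 1) ≤ m - b := by omega
      have h4 := Nat.mul_le_mul_left (m.choose b) h3
      refine Nat.le_of_mul_le_mul_right (c := b + 1) ?_ (by omega)
      rw [h2]; linarith
    rw [Nat.sub_add_comm hjb, pow_succ, ← mul_assoc]
    exact (Nat.mul_le_mul_right 2 (ih (by omega))).trans h1

/-- The left side equals `C(m, j) / C(m, b)`, and consecutive binomial coefficients at least double
up to `b`. -/
theorem choose_mul_inv_choose_le {m j b : ℕ} (hjb : j ≤ b) (hb : 3 * b ≤ m) :
    (b.choose j : ℝ) * ((m - j).choose (b - j) : ℝ)⁻¹ ≤ 2 ^ j / 2 ^ b := by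
  have h1 := Nat.choose_mul (n := m) (k := b) (s := j) hjb
  have h2 := choose_mul_two_pow_le hjb hb
  have h3 : 0 < (m - j).choose (b - j) := Nat.choose_pos (by omega)
  have h4 : 0 < m.choose j := Nat.choose_pos (by omega)
  have h5 : b.choose j * 2 ^ (b - j) ≤ (m - j).choose (b - j) := by
    refine Nat.le_of_mul_le_mul_left (c := m.choose j) ?_ h4
    rw [← h1]
    calc m.choose j * (b.choose j * 2 ^ (b - j))
        = (m.choose j * 2 ^ (b - j)) * b.choose j := by ring
      _ ≤ _ := Nat.mul_le_mul_right _ h2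
  have h6 : (2 : ℝ) ^ b = 2 ^ j * 2 ^ (b - j) := by rw [← pow_add]; congr 1; omega
  rw [← div_eq_mul_inv, div_le_div_iff₀ (by exact_mod_cast h3) (by positivity), h6]
  have h7 : (b.choose j : ℝ) * 2 ^ (b - j) ≤ ((m - j).choose (b - j) : ℝ) := by exact_mod_cast h5
  have := mul_le_mul_of_nonneg_left h7 (by positivity : (0 : ℝ) ≤ 2 ^ j)
  linarith

theorem sum_range_two_pow_le (k : ℕ) : ∑ j ∈ range k, (2 : ℝ) ^ j ≤ 2 ^ k := by
  rw [geom_sum_eq (by norm_num)]; norm_num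

/-! ### Random increasing chains in the hypercube. -/

section Hypercube

variable {m : ℕ}

/-- The probability that a uniformly random increasing chain of sets that starts at `A` passes
through `a`. -/
noncomputable def chainProb (A a : Finset (Fin m)) : ℝ :=
  if A ⊆ a then ((m - #A).choose (#a - #A) : ℝ)⁻¹ else 0

/-- The rate at which the random chain from `A`, stopped at size `T`, leaves `a` in each of the
`m - #a` upward directions. -/
noncomputable def outRate (T : ℕ) (A a : Finset (Fin m)) : ℝ :=
  if #a < T then chainProb A a / (m - #a) else 0

/-- The flow on the hypercube along random increasing chains from `A` to sets of size `T`. -/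
noncomputable def chainFlow (T : ℕ) (A a b : Finset (Fin m)) : ℝ :=
  ∑ x, if x ∉ a ∧ b = insert x a then outRate T A a else 0

/-- The flow that leaves the hypercube at `a`. -/
noncomputable def exitFlow (T : ℕ) (A a : Finset (Fin m)) : ℝ :=
  if #a = T then chainProb A a else 0

theorem chainProb_nonneg (A a : Finset (Fin m)) : 0 ≤ chainProb A a := by
  unfold chainProb; split_ifs <;> positivity

theorem card_le_dim (a : Finset (Fin m)) : #a ≤ m := by
  simpa using card_le_univ a

theorem outRate_nonneg (T : ℕ) (A a : Finset (Fin m)) : 0 ≤ outRate T A a := by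
  unfold outRate
  split_ifs
  · refine div_nonneg (chainProb_nonneg A a) (sub_nonneg.2 ?_)
    exact_mod_cast card_le_dim a
  · rfl

theorem chainFlow_nonneg (T : ℕ) (A a b : Finset (Fin m)) : 0 ≤ chainFlow T A a b :=
  sum_nonneg fun x _ => by split_ifs; exacts [outRate_nonneg T A a, le_rfl]

theorem exitFlow_nonneg (T : ℕ) (A a : Finset (Fin m)) : 0 ≤ exitFlow T A a := by
  unfold exitFlow; split_ifs; exacts [chainProb_nonneg A a, le_rfl]

theorem chainFlow_eq_zero {T : ℕ} {A a b : Finset (Fin m)}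
    (h : ¬ ∃ x, x ∉ a ∧ b = insert x a) : chainFlow T A a b = 0 :=
  sum_eq_zero fun x _ => if_neg fun hx => h ⟨x, hx⟩

theorem chainFlow_le_outRate (T : ℕ) (A a b : Finset (Fin m)) :
    chainFlow T A a b ≤ outRate T A a := by
  by_cases h : ∃ x, x ∉ a ∧ b = insert x a
  · obtain ⟨x, hx, rfl⟩ := h
    unfold chainFlow
    rw [sum_eq_single x]
    · split_ifs; exacts [le_rfl, outRate_nonneg T A a]
    · intro y _ hy
      refine if_neg fun ⟨h1, h2⟩ => hy ?_
      have : x ∈ insert y a := h2 ▸ mem_insert_self x a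
      rcases mem_insert.1 this with h | h
      exacts [h.symm, absurd h hx]
    · simp
  · rw [chainFlow_eq_zero h]; exact outRate_nonneg T A a

theorem sum_chainFlow_right {T : ℕ} (hT : T ≤ m) (A a : Finset (Fin m)) :
    ∑ b, chainFlow T A a b = if #a < T then chainProb A a else 0 := by
  unfold chainFlow
  rw [sum_comm]
  have : ∀ x, ∑ b, (if x ∉ a ∧ b = insert x a then outRate T A a else 0)
      = if x ∉ a then outRate T A a else 0 := by
    intro x; by_cases hx : x ∈ a <;> simp [hx]
  simp_rw [this]
  rw [← sum_filter, sum_const, filter_not, card_sdiff_of_subset (filter_subset _ _)]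
  simp only [card_univ, Fintype.card_fin, filter_univ_mem, nsmul_eq_mul, outRate]
  split_ifs with h
  · rw [Nat.cast_sub (card_le_dim a), mul_div_cancel₀]
    have : (#a : ℝ) < m := by exact_mod_cast h.trans_le hT
    linarith
  · simp

/-- A chain reaches `a` from some `a.erase x` with `x ∈ a \ A`. Summing these equal contributions
recovers `chainProb A a` by the identity `C(M, j+1) (j+1) = C(M, j) (M-j)` with `M = m - #A`. -/
theorem sum_chainFlow_left (T : ℕ) (A a : Finset (Fin m)) :
    ∑ b, chainFlow T A b a = if #a ≤ T ∧ a ≠ A then chainProb A a else 0 := by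
  have h1 : ∑ b, chainFlow T A b a = ∑ x ∈ a, outRate T A (a.erase x) := by
    unfold chainFlow
    rw [sum_comm, ← sum_subset (subset_univ a)]
    · refine sum_congr rfl fun x hx => ?_
      rw [sum_eq_single (a.erase x)]
      · simp [insert_erase hx]
      · intro b _ hb
        refine if_neg fun ⟨h1, h2⟩ => hb ?_
        rw [h2, erase_insert h1]
      · simp
    · intro x _ hx
      refine sum_eq_zero fun b _ => if_neg fun h => hx ?_
      rw [h.2]; exact mem_insert_self x b
  rw [h1]
  by_cases hA : A ⊆ a
  swap
  · have h2 : ∀ x, chainProb A (a.erase x) = 0 := fun x =>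
      if_neg fun h => hA (h.trans (erase_subset x a))
    have h3 : chainProb A a = 0 := if_neg hA
    simp only [outRate, h2, h3, zero_div, ite_self, sum_const_zero]
  have h3 : ∑ x ∈ a, outRate T A (a.erase x) = ∑ x ∈ a \ A, outRate T A (a.erase x) := by
    symm
    refine sum_subset sdiff_subset fun x hx hx' => ?_
    have hxA : x ∈ A := by simpa [hx] using hx'
    have : chainProb A (a.erase x) = 0 := if_neg fun h => by simpa using h hxA
    simp [outRate, this]
  have h4 : ∀ x ∈ a \ A, outRate T A (a.erase x)
      = if #a ≤ T then ((m - #A).choose (#a - 1 - #A) : ℝ)⁻¹ / (m - (#a - 1 : ℕ)) else 0 := by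
    intro x hx
    rw [mem_sdiff] at hx
    have hpos : 0 < #a := card_pos.2 ⟨x, hx.1⟩
    have : A ⊆ a.erase x := subset_erase.2 ⟨hA, hx.2⟩
    rw [outRate, chainProb, card_erase_of_mem hx.1, if_pos this]
    congr 1
    exact propext (by omega)
  rw [h3, sum_congr rfl h4, sum_const, card_sdiff_of_subset hA, nsmul_eq_mul, chainProb, if_pos hA]
  by_cases hne : a = A
  · simp [hne]
  have hlt : #A < #a := card_lt_card (hA.ssubset_of_ne (Ne.symm hne))
  by_cases haT : #a ≤ T
  swap
  · simp [haT]
  rw [if_pos haT, if_pos ⟨haT, hne⟩]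
  have ham := card_le_dim a
  obtain ⟨j, hj⟩ : ∃ j, #a = #A + (j + 1) := ⟨#a - #A - 1, by omega⟩
  have e1 : #a - #A = j + 1 := by omega
  have e2 : #a - 1 - #A = j := by omega
  have e3 : ((m : ℝ) - (#a - 1 : ℕ)) = ((m - #A - j : ℕ) : ℝ) := by
    rw [← Nat.cast_sub (by omega)]; congr 1; omega
  rw [e1, e2, e3]
  have h5 := Nat.choose_succ_right_eq (m - #A) j
  have h5' : ((m - #A).choose (j + 1) : ℝ) * ((j + 1 : ℕ) : ℝ)
      = (m - #A).choose j * (m - #A - j : ℕ) := by exact_mod_cast h5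
  have p1 : (0 : ℝ) < (m - #A).choose (j + 1) := by
    exact_mod_cast Nat.choose_pos (by omega)
  have p2 : (0 : ℝ) < (m - #A).choose j := by
    exact_mod_cast Nat.choose_pos (by omega)
  have p3 : (0 : ℝ) < (m - #A - j : ℕ) := by
    exact_mod_cast (by omega : 0 < m - #A - j)
  rw [inv_eq_one_div, div_div, inv_eq_one_div, ← mul_div_assoc, div_eq_div_iff (by positivity)
    (by positivity)]
  linarith

theorem chainFlow_conservation {T : ℕ} (hT : T ≤ m) {A : Finset (Fin m)} (hA : #A ≤ T)
    (a : Finset (Fin m)) :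
    ∑ b, chainFlow T A a b + exitFlow T A a - ∑ b, chainFlow T A b a = if a = A then 1 else 0 := by
  rw [sum_chainFlow_right hT, sum_chainFlow_left, exitFlow]
  by_cases h : a = A
  · subst h
    have : chainProb a a = 1 := by simp [chainProb]
    rcases hA.lt_or_eq with h | h
    · simp [h, h.ne, this]
    · simp [h, this]
  · rcases lt_trichotomy #a T with h' | h' | h'
    · simp [h, h', h'.ne, h'.le]
    · simp [h, h']
    · simp [h, h'.not_ge, h'.ne', h'.not_gt]

/-- Only subsets of `a` contribute; they are grouped by their size `j`. -/
theorem sum_chainProb_le {R : ℕ} {a : Finset (Fin m)} (ha : 3 * #a ≤ m) :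
    ∑ A, (if #A ≤ R then chainProb A a else 0)
      ≤ ∑ j ∈ range (#a + 1), if j ≤ R then (2 : ℝ) ^ j / 2 ^ #a else 0 := by
  have h1 : ∑ A, (if #A ≤ R then chainProb A a else 0)
      = ∑ A ∈ a.powerset,
          (fun j => if j ≤ R then ((m - j).choose (#a - j) : ℝ)⁻¹ else 0) #A := by
    rw [← sum_subset (subset_univ a.powerset)]
    · refine sum_congr rfl fun A hA => ?_
      simp [chainProb, mem_powerset.1 hA]
    · intro A _ hA
      simp [chainProb, mem_powerset.not.1 hA]
  refine (h1.trans (sum_powerset_apply_card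
    (fun j => if j ≤ R then ((m - j).choose (#a - j) : ℝ)⁻¹ else 0))).trans_le ?_
  refine sum_le_sum fun j hj => ?_
  rw [nsmul_eq_mul]
  split_ifs
  · exact choose_mul_inv_choose_le (by simpa [Nat.lt_succ_iff] using hj) ha
  · simp

theorem sum_chainProb_le_two {R : ℕ} {a : Finset (Fin m)} (ha : 3 * #a ≤ m) :
    ∑ A, (if #A ≤ R then chainProb A a else 0) ≤ 2 := by
  refine (sum_chainProb_le ha).trans ?_
  calc _ ≤ ∑ j ∈ range (#a + 1), (2 : ℝ) ^ j / 2 ^ #a :=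
        sum_le_sum fun j _ => by split_ifs; exacts [le_rfl, by positivity]
    _ ≤ 2 ^ (#a + 1) / 2 ^ #a := by
        rw [← sum_div]
        exact div_le_div_of_nonneg_right (sum_range_two_pow_le _) (by positivity)
    _ = 2 := by rw [pow_succ]; field_simp

/-- Cutting the geometric sum at `R` gives exponential decay in `#a - R`, which makes the exits at
size `2R` cheap. -/
theorem sum_chainProb_le_pow {R : ℕ} {a : Finset (Fin m)} (ha : 3 * #a ≤ m) :
    ∑ A, (if #A ≤ R then chainProb A a else 0) ≤ 2 ^ (R + 1) / 2 ^ #a := by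
  refine (sum_chainProb_le ha).trans ?_
  calc _ = ∑ j ∈ (range (#a + 1)).filter (· ≤ R), (2 : ℝ) ^ j / 2 ^ #a := by rw [sum_filter]
    _ ≤ ∑ j ∈ range (R + 1), (2 : ℝ) ^ j / 2 ^ #a := by
        refine sum_le_sum_of_subset_of_nonneg (fun j hj => ?_) fun _ _ _ => by positivity
        simp only [mem_filter, mem_range] at hj ⊢
        omega
    _ ≤ 2 ^ (R + 1) / 2 ^ #a := by
        rw [← sum_div]
        exact div_le_div_of_nonneg_right (sum_range_two_pow_le _) (by positivity)

/-- Total flow at most 2 passes through `a`, and below size `2R` it splits evenly over at least `4R`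
upward directions. -/
theorem sum_chainFlow_le {R : ℕ} (hR : 0 < R) (hm : m = 6 * R) (a b : Finset (Fin m)) :
    ∑ A, (if #A ≤ R then chainFlow (2 * R) A a b else 0) ≤ 1 / (2 * R) := by
  have hR' : (0 : ℝ) < R := by exact_mod_cast hR
  calc _ ≤ ∑ A, (if #A ≤ R then outRate (2 * R) A a else 0) :=
        sum_le_sum fun A _ => by split_ifs; exacts [chainFlow_le_outRate _ _ _ _, le_rfl]
    _ ≤ 1 / (2 * R) := by
        unfold outRate
        by_cases ha : #a < 2 * R
        · have h1 := sum_chainProb_le_two (R := R) (a := a) (by omega)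
          have h2 : (4 * R : ℝ) ≤ m - #a := by
            have : ((4 * R + #a : ℕ) : ℝ) ≤ (m : ℝ) := by exact_mod_cast (by omega)
            push_cast at this; linarith
          calc _ = (∑ A, (if #A ≤ R then chainProb A a else 0)) / (m - #a) := by
                rw [sum_div]
                refine sum_congr rfl fun A _ => ?_
                split_ifs <;> simp
            _ ≤ 2 / (4 * R) := div_le_div₀ (by norm_num) h1 (by positivity) h2
            _ = 1 / (2 * R) := by field_simp; norm_num
        · simp only [ha, if_false, ite_self, sum_const_zero]
          positivity

theorem sum_exitFlow_le {R : ℕ} (hm : m = 6 * R) (a : Finset (Fin m)) :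
    ∑ A, (if #A ≤ R then exitFlow (2 * R) A a else 0) ≤ 2 / 2 ^ R := by
  unfold exitFlow
  by_cases ha : #a = 2 * R
  · simp only [ha, if_true]
    refine (sum_chainProb_le_pow (by omega)).trans_eq ?_
    rw [ha, pow_succ, two_mul, pow_add]
    field_simp
  · simp only [ha, if_false, ite_self, sum_const_zero]
    positivity

end Hypercube

/-! ### The hub network, its ball routings and the dual potential. -/

section Construction

variable {m : ℕ}

/-- The nodes: a hub `none`, the vertices `some (inl a)` of the hypercube, and a pendant node
`some (inr v)` for each vertex `v` of the hypercube. Every node but the hub is also a commodity,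
with the hub as its other endpoint. -/
abbrev HubNode (m : ℕ) : Type := Option (Finset (Fin m) ⊕ Finset (Fin m))

/-- The hypercube with all its vertices and all pendant nodes joined to the hub. -/
def hubGraph (m : ℕ) : SimpleGraph (HubNode m) where
  Adj
    | some (.inl a), some (.inl b) => #(symmDiff a b) = 1
    | some _, none => True
    | none, some _ => True
    | _, _ => False
  symm := ⟨by
    rintro (_ | a | a) (_ | b | b) <;> simp [symmDiff_comm]⟩
  loopless := ⟨by
    rintro (_ | a | a) <;> simp⟩

/-- The edge weight with value `x` inside the hypercube, `y` from the hypercube to the hub, and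
`z` from the pendant nodes to the hub. -/
def hubWeight (x y z : ℝ) : HubNode m → HubNode m → ℝ
  | some (.inl _), some (.inl _) => x
  | some (.inl _), none => y
  | none, some (.inl _) => y
  | some (.inr _), none => z
  | none, some (.inr _) => z
  | _, _ => 0

theorem hubWeight_comm (x y z : ℝ) (p q : HubNode m) : hubWeight x y z p q = hubWeight x y z q p := by
  rcases p with _ | a | a <;> rcases q with _ | b | b <;> rfl

theorem hubWeight_nonneg {x y z : ℝ} (hx : 0 ≤ x) (hy : 0 ≤ y) (hz : 0 ≤ z) (p q : HubNode m) :
    0 ≤ hubWeight x y z p q := by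
  rcases p with _ | a | a <;> rcases q with _ | b | b <;> simp [hubWeight, *]

/-- The demand vector with unit demand on the ball of radius `R` around `v`, and on the pendant
node of `v`. -/
def ballDemand (R : ℕ) (v : Finset (Fin m)) : Finset (Fin m) ⊕ Finset (Fin m) → ℝ
  | .inl i => if #(symmDiff i v) ≤ R then 1 else 0
  | .inr w => if w = v then 1 else 0

theorem ballDemand_nonneg (R : ℕ) (v : Finset (Fin m)) (h) : 0 ≤ ballDemand R v h := by
  rcases h with i | w <;> simp only [ballDemand] <;> split_ifs <;> norm_num

theorem ballDemand_le_one (R : ℕ) (v : Finset (Fin m)) (h) : ballDemand R v h ≤ 1 := by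
  rcases h with i | w <;> simp only [ballDemand] <;> split_ifs <;> norm_num

theorem ballDemand_self (R : ℕ) : ∀ h, ∃ v : Finset (Fin m), ballDemand R v h = 1
  | .inl i => ⟨i, by simp [ballDemand]⟩
  | .inr w => ⟨w, by simp [ballDemand]⟩

/-- A routing of `ballDemand R v` that moves away from `v` before it leaves for the hub. -/
noncomputable def ballFlow (R : ℕ) (v : Finset (Fin m)) :
    Finset (Fin m) ⊕ Finset (Fin m) → HubNode m → HubNode m → ℝ
  | .inl i, some (.inl a), some (.inl b) => if #(symmDiff i v) ≤ R then
      chainFlow (2 * R) (symmDiff i v) (symmDiff a v) (symmDiff b v) else 0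
  | .inl i, some (.inl a), none => if #(symmDiff i v) ≤ R then
      exitFlow (2 * R) (symmDiff i v) (symmDiff a v) else 0
  | .inr w, some (.inr x), none => if w = v ∧ x = w then 1 else 0
  | _, _, _ => 0

theorem ballFlow_nonneg (R : ℕ) (v : Finset (Fin m)) (h) (p q : HubNode m) :
    0 ≤ ballFlow R v h p q := by
  rcases h with i | w <;> rcases p with _ | a | a <;> rcases q with _ | b | b <;>
    simp only [ballFlow, le_refl] <;> split_ifs <;>
    first | exact chainFlow_nonneg _ _ _ _ | exact exitFlow_nonneg _ _ _ | norm_num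

theorem card_symmDiff_insert {a : Finset (Fin m)} {x : Fin m} (hx : x ∉ a) :
    #(symmDiff a (insert x a)) = 1 := by
  have : symmDiff a (insert x a) = {x} := by
    ext y
    simp only [mem_symmDiff, mem_insert, mem_singleton]
    constructor
    · tauto
    · rintro rfl; tauto
  rw [this, card_singleton]

theorem symmDiff_symmDiff_right_cancel (a b v : Finset (Fin m)) :
    symmDiff (symmDiff a v) (symmDiff b v) = symmDiff a b := by
  rw [symmDiff_comm b v, symmDiff_assoc, symmDiff_symmDiff_cancel_left]

theorem ballFlow_support (R : ℕ) (v : Finset (Fin m)) (h) (p q : HubNode m)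
    (hpq : ¬ (hubGraph m).Adj p q) : ballFlow R v h p q = 0 := by
  rcases h with i | w <;> rcases p with _ | a | a <;> rcases q with _ | b | b <;>
    simp only [ballFlow] <;> try exact absurd trivial hpq
  rw [chainFlow_eq_zero, ite_self]
  rintro ⟨x, hx, hb⟩
  refine hpq ?_
  change #(symmDiff a b) = 1
  rw [← symmDiff_symmDiff_right_cancel a b v, hb, card_symmDiff_insert hx]

theorem sum_symmDiff_right {M : Type*} [AddCommMonoid M] (v : Finset (Fin m))
    (f : Finset (Fin m) → M) : ∑ a, f (symmDiff a v) = ∑ a, f a :=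
  Equiv.sum_comp (symmDiff_left_involutive v).toPerm f

theorem ballFlow_conservation {R : ℕ} (hR : 2 * R ≤ m) (v : Finset (Fin m)) (h) (p : HubNode m)
    (hp : p ≠ none) : ∑ q, ballFlow R v h p q - ∑ q, ballFlow R v h q p
      = ballDemand R v h * if p = some h then 1 else 0 := by
  rcases h with i | w <;> rcases p with _ | a | x <;>
    simp only [Fintype.sum_option, Fintype.sum_sum_type, ballFlow, ballDemand, sum_const_zero,
      Option.some.injEq, Sum.inl.injEq, Sum.inr.injEq, reduceCtorEq, if_false] <;>
    try simp only [ne_eq, not_true_eq_false] at hp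
  · by_cases hi : #(symmDiff i v) ≤ R
    · simp only [hi, if_true]
      -- Symmetric difference with `v` is an automorphism of the cube taking `v` to `∅`.
      have h1 := chainFlow_conservation hR (hi.trans (by omega : R ≤ 2 * R)) (symmDiff a v)
      rw [← sum_symmDiff_right v (fun b => chainFlow (2 * R) (symmDiff i v) (symmDiff a v) b),
        ← sum_symmDiff_right v (fun b => chainFlow (2 * R) (symmDiff i v) b (symmDiff a v))] at h1
      have h2 : symmDiff a v = symmDiff i v ↔ a = i := symmDiff_left_inj
      simp only [h2] at h1
      linarith
    · simp [hi]
  · simp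
  · simp
  · by_cases hw : w = v <;> by_cases hx : x = w <;> simp [hw, hx]

theorem sum_ballFlow_add_le {R : ℕ} (hR : 0 < R) (hm : m = 6 * R) (v : Finset (Fin m))
    (p q : HubNode m) : ∑ h, (ballFlow R v h p q + ballFlow R v h q p)
      ≤ hubWeight (1 / R) (2 / 2 ^ R) 1 p q := by
  have exit : ∀ a : Finset (Fin m), ∑ i, (if #(symmDiff i v) ≤ R then
      exitFlow (2 * R) (symmDiff i v) (symmDiff a v) else 0) ≤ 2 / 2 ^ R := fun a => by
    rw [sum_symmDiff_right v (fun i => if #i ≤ R then exitFlow (2 * R) i (symmDiff a v) else 0)]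
    exact sum_exitFlow_le hm _
  have chain : ∀ a b : Finset (Fin m), ∑ i, (if #(symmDiff i v) ≤ R then
      chainFlow (2 * R) (symmDiff i v) (symmDiff a v) (symmDiff b v) else 0) ≤ 1 / (2 * R) :=
    fun a b => by
      rw [sum_symmDiff_right v
        (fun i => if #i ≤ R then chainFlow (2 * R) i (symmDiff a v) (symmDiff b v) else 0)]
      exact sum_chainFlow_le hR hm _ _
  have pendant : ∀ x : Finset (Fin m), ∑ w, (if w = v ∧ x = w then (1 : ℝ) else 0) ≤ 1 :=
    fun x => by
      calc _ ≤ ∑ w, (if w = v then (1 : ℝ) else 0) := sum_le_sum fun w _ => by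
            split_ifs <;> simp_all
        _ = 1 := by simp
  rw [sum_add_distrib]
  rcases p with _ | a | x <;> rcases q with _ | b | y <;>
    simp only [Fintype.sum_sum_type, ballFlow, hubWeight, sum_const_zero, add_zero, zero_add,
      le_refl, exit, pendant]
  -- A cube edge may be used in both directions, each with load at most `1 / (2R)`.
  have h1 := chain a b
  have h2 := chain b a
  have h3 : (1 : ℝ) / R = 1 / (2 * R) + 1 / (2 * R) := by field_simp; norm_num
  linarith

/-- A truncated distance from `h` in the hypercube. -/
def hubPotential (R : ℕ) : Finset (Fin m) ⊕ Finset (Fin m) → HubNode m → ℝ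
  | .inl i, some (.inl a) => (min #(symmDiff i a) R : ℕ)
  | .inl _, _ => R
  | .inr _, _ => 0

theorem hubPotential_sub_le (R : ℕ) {p q : HubNode m} (hpq : (hubGraph m).Adj p q) :
    ∃ v, ∀ h, hubPotential R h q - hubPotential R h p
        ≤ hubWeight 1 R 0 p q * ballDemand R v h ∧
      hubPotential R h p - hubPotential R h q ≤ hubWeight 1 R 0 p q * ballDemand R v h := by
  have hub : ∀ i a : Finset (Fin m),
      (R : ℝ) - (min #(symmDiff i a) R : ℕ) ≤ R * (if #(symmDiff i a) ≤ R then 1 else 0) ∧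
      (min #(symmDiff i a) R : ℕ) - (R : ℝ) ≤ R * (if #(symmDiff i a) ≤ R then 1 else 0) := by
    intro i a
    split_ifs with h
    · have h1 : (0 : ℝ) ≤ (min #(symmDiff i a) R : ℕ) := Nat.cast_nonneg _
      have h2 : ((min #(symmDiff i a) R : ℕ) : ℝ) ≤ R := by exact_mod_cast min_le_right _ _
      have h3 : (0 : ℝ) ≤ R := Nat.cast_nonneg _
      constructor <;> linarith
    · rw [min_eq_right (by omega)]; simp
  rcases p with _ | a | x <;> rcases q with _ | b | y
  · exact absurd hpq id
  · refine ⟨b, ?_⟩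
    rintro (i | w)
    · simpa [hubPotential, hubWeight, ballDemand] using (hub i b).symm
    · simp only [hubPotential, hubWeight, sub_self, and_self]
      exact mul_nonneg (Nat.cast_nonneg _) (ballDemand_nonneg _ _ _)
  · exact ⟨∅, by rintro (i | w) <;> simp [hubPotential, hubWeight]⟩
  · refine ⟨a, ?_⟩
    rintro (i | w)
    · simpa [hubPotential, hubWeight, ballDemand] using hub i a
    · simp only [hubPotential, hubWeight, sub_self, and_self]
      exact mul_nonneg (Nat.cast_nonneg _) (ballDemand_nonneg _ _ _)
  · refine ⟨a, ?_⟩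
    rintro (i | w)
    · have hab : #(symmDiff a b) = 1 := hpq
      have h1 : #(symmDiff i b) ≤ #(symmDiff i a) + 1 := by
        rw [← hab]
        exact (card_le_card (symmDiff_triangle i a b)).trans (card_union_le _ _)
      have h2 : #(symmDiff i a) ≤ #(symmDiff i b) + 1 := by
        rw [← hab, symmDiff_comm a b]
        exact (card_le_card (symmDiff_triangle i b a)).trans (card_union_le _ _)
      simp only [hubPotential, hubWeight, ballDemand, sub_le_iff_le_add, one_mul]
      -- If `i` lies outside the ball around `a`, then both endpoints are at distance at least `R`
      -- from `i`, so truncation makes the difference zero.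
      split_ifs with h
      · constructor <;> norm_cast <;> omega
      · constructor <;> norm_cast <;> omega
    · simp only [hubPotential, hubWeight, sub_self, and_self, one_mul]
      exact ballDemand_nonneg _ _ _
  · exact absurd hpq id
  · exact ⟨∅, by rintro (i | w) <;> simp [hubPotential, hubWeight]⟩
  · exact absurd hpq id
  · exact absurd hpq id

theorem sum_hubWeight (x y : ℝ) [DecidableRel (hubGraph m).Adj] :
    ∑ p : HubNode m, ∑ q : HubNode m,
      (if (hubGraph m).Adj p q then hubWeight x y 0 p q / 2 else 0)
      = 2 ^ m * (m * x / 2 + y) := by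
  have h1 : ∀ a : Finset (Fin m),
      ∑ b, (if (hubGraph m).Adj (some (.inl a)) (some (.inl b)) then x / 2 else 0)
      = m * (x / 2) := by
    intro a
    have h : ∀ b, (hubGraph m).Adj (some (.inl a)) (some (.inl b)) ↔ #(symmDiff b a) = 1 :=
      fun b => by rw [symmDiff_comm]; rfl
    simp_rw [h]
    rw [sum_symmDiff_right a (fun b => if #b = 1 then x / 2 else 0), ← sum_filter, sum_const,
      univ_filter_card_eq, card_powersetCard]
    simp
  have h2 : ∀ p, (hubGraph m).Adj (some p) none := fun p => by rcases p with a | a <;> trivial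
  have h3 : ∀ p, (hubGraph m).Adj none (some p) := fun p => (h2 p).symm
  simp only [Fintype.sum_option, Fintype.sum_sum_type, hubWeight, h2, h3, if_true,
    h1, sum_const_zero, zero_div, ite_self, add_zero, zero_add, sum_const, card_univ,
    Fintype.card_finset, Fintype.card_fin, nsmul_eq_mul]
  push_cast
  ring

end Construction

/-! ### The instance on numbered nodes and its two bounds. -/

section Instance

/-- A numbering of the nodes. -/
noncomputable def nodeEquiv (m : ℕ) : HubNode m ≃ Fin (Fintype.card (HubNode m)) :=
  Fintype.equivFin _

/-- A numbering of the commodities. -/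
noncomputable def commodityEquiv (m : ℕ) :
    Finset (Fin m) ⊕ Finset (Fin m) ≃ Fin (Fintype.card (Finset (Fin m) ⊕ Finset (Fin m))) :=
  Fintype.equivFin _

/-- The convex combinations of the demand vectors `ballDemand R v`; the demand of the pendant node
of `v` is the coefficient of `ballDemand R v`. -/
def ballDemands (m R : ℕ) : Set (Fin (Fintype.card (Finset (Fin m) ⊕ Finset (Fin m))) → ℝ) :=
  {d | (∀ h, 0 ≤ d h) ∧ ∑ v, d (commodityEquiv m (.inr v)) = 1 ∧
    ∀ h, d h = ∑ v, d (commodityEquiv m (.inr v)) * ballDemand R v ((commodityEquiv m).symm h)}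

theorem isPolyhedral_ballDemands (m R : ℕ) : IsPolyhedral (ballDemands m R) := by
  have h1 := isPolyhedral_setOf_forall_le
    (fun h => -(LinearMap.proj h :
      (Fin (Fintype.card (Finset (Fin m) ⊕ Finset (Fin m))) → ℝ) →ₗ[ℝ] ℝ)) (fun _ => 0)
  have h2 := isPolyhedral_setOf_forall_eq
    (fun _ : Unit => ∑ v, (LinearMap.proj (commodityEquiv m (.inr v)) :
      (Fin (Fintype.card (Finset (Fin m) ⊕ Finset (Fin m))) → ℝ) →ₗ[ℝ] ℝ)) (fun _ => 1)
  have h3 := isPolyhedral_setOf_forall_eq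
    (fun h => (LinearMap.proj h : (Fin (Fintype.card (Finset (Fin m) ⊕ Finset (Fin m))) → ℝ) →ₗ[ℝ] ℝ)
      - ∑ v, ballDemand R v ((commodityEquiv m).symm h) •
        (LinearMap.proj (commodityEquiv m (.inr v)) :
          (Fin (Fintype.card (Finset (Fin m) ⊕ Finset (Fin m))) → ℝ) →ₗ[ℝ] ℝ)) (fun _ => 0)
  convert h1.inter (h2.inter h3) using 1
  ext d
  simp [ballDemands, sub_eq_zero, mul_comm]

theorem ballDemand_mem_ballDemands {m : ℕ} (R : ℕ) (v : Finset (Fin m)) :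
    (fun h => ballDemand R v ((commodityEquiv m).symm h)) ∈ ballDemands m R := by
  refine ⟨fun h => ballDemand_nonneg _ _ _, ?_, fun h => ?_⟩
  · simp [ballDemand]
  · simp only [Equiv.symm_apply_apply]
    rw [sum_eq_single v]
    · simp [ballDemand]
    · intro w _ hw
      simp [ballDemand, hw]
    · simp

theorem le_one_of_mem_ballDemands {m R : ℕ} {d} (hd : d ∈ ballDemands m R) (h) : d h ≤ 1 := by
  obtain ⟨h0, h1, h2⟩ := hd
  rw [h2, ← h1]
  exact sum_le_sum fun v _ => mul_le_of_le_one_right (h0 _) (ballDemand_le_one _ _ _)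

/-- Demands from balls in the hypercube to the hub. -/
noncomputable def hubInstance (m R : ℕ) : RobustInstance (Fintype.card (HubNode m)) where
  G := (hubGraph m).comap (nodeEquiv m).symm
  k := Fintype.card (Finset (Fin m) ⊕ Finset (Fin m))
  src h := nodeEquiv m (some ((commodityEquiv m).symm h))
  tgt _ := nodeEquiv m none
  src_ne_tgt h := by simp
  pairs_injective h h' := by simp
  D := ballDemands m R
  D_polyhedral := isPolyhedral_ballDemands m R
  D_nonempty := ⟨_, ballDemand_mem_ballDemands R ∅⟩
  D_nonneg d hd := hd.1
  lam e := Sym2.lift ⟨hubWeight 1 R 0, hubWeight_comm 1 R 0⟩ (Sym2.map (nodeEquiv m).symm e)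
  lam_nonneg e := by
    obtain ⟨e, he⟩ := e
    induction e using Sym2.ind with
    | _ a b => exact hubWeight_nonneg zero_le_one (Nat.cast_nonneg R) le_rfl _ _

variable {m R : ℕ}

theorem isFlow_ballFlow (hR : 2 * R ≤ m) (v : Finset (Fin m)) (h : Fin (hubInstance m R).k) :
    IsFlow (hubInstance m R).G ((hubInstance m R).src h) ((hubInstance m R).tgt h)
      (ballDemand R v ((commodityEquiv m).symm h)) (fun a b =>
        ballFlow R v ((commodityEquiv m).symm h) ((nodeEquiv m).symm a) ((nodeEquiv m).symm b)) := by
  refine .of_conservation_ne (fun a b => ballFlow_nonneg _ _ _ _ _)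
    (fun a b hab => ballFlow_support _ _ _ _ _ hab) fun x hx => ?_
  have hx' : (nodeEquiv m).symm x ≠ none := by
    rwa [Ne, Equiv.symm_apply_eq]
  rw [if_neg hx, sub_zero,
    (nodeEquiv m).symm.sum_comp (fun q => ballFlow R v _ ((nodeEquiv m).symm x) q),
    (nodeEquiv m).symm.sum_comp (fun q => ballFlow R v _ q ((nodeEquiv m).symm x)),
    ballFlow_conservation hR v _ _ hx']
  simp only [Equiv.symm_apply_eq]
  rfl

theorem statCapacities_hubInstance_nonempty (hR : 2 * R ≤ m) :
    (hubInstance m R).statCapacities.Nonempty := by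
  -- Any ball routing that gives `h` unit demand supplies a unit flow for `h`; demands never exceed
  -- 1, so the summed loads are enough capacity.
  choose v hv using fun h => ballDemand_self R ((commodityEquiv m).symm h)
  refine ⟨fun e => ∑ h, edgeLoad (fun a b => ballFlow R (v h) ((commodityEquiv m).symm h)
    ((nodeEquiv m).symm a) ((nodeEquiv m).symm b)) e, _,
    fun h => hv h ▸ isFlow_ballFlow hR (v h) h, fun d hd e => ?_⟩
  refine sum_le_sum fun h _ => mul_le_of_le_one_left ?_ (le_one_of_mem_ballDemands hd h)
  exact edgeLoad_nonneg (fun a b => ballFlow_nonneg _ _ _ _ _) _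

/-- Capacities that suffice for dynamic routing in `hubInstance m R`. -/
noncomputable def hubCapacity (m R : ℕ) (e : (hubInstance m R).G.edgeSet) : ℝ :=
  Sym2.lift ⟨hubWeight (1 / R) (2 / 2 ^ R) 1, hubWeight_comm _ _ _⟩
    (Sym2.map (nodeEquiv m).symm e)

/-- The pendant demands are the convex coefficients with which the ball routings are mixed, and one
capacity vector bounds all of them. -/
theorem hubCapacity_mem_dynCapacities (hR : 0 < R) (hm : m = 6 * R) :
    hubCapacity m R ∈ (hubInstance m R).dynCapacities := by
  intro d hd
  obtain ⟨h0, h1, h2⟩ := hd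
  refine ⟨fun h a b => ∑ v, d (commodityEquiv m (.inr v)) *
    ballFlow R v ((commodityEquiv m).symm h) ((nodeEquiv m).symm a) ((nodeEquiv m).symm b),
    fun h => ?_, ?_⟩
  · rw [h2 h]
    exact IsFlow.sum_mul (fun v => h0 _) fun v => isFlow_ballFlow (by omega) v h
  · rintro ⟨e, he⟩
    induction e using Sym2.ind with
    | _ a b =>
      set p := (nodeEquiv m).symm a
      set q := (nodeEquiv m).symm b
      change _ ≤ hubWeight (1 / R) (2 / 2 ^ R) 1 p q
      simp only [edgeLoad_mk, ← sum_add_distrib, ← mul_add]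
      rw [sum_comm]
      simp only [← mul_sum]
      calc _ ≤ ∑ v, d (commodityEquiv m (.inr v)) * hubWeight (1 / R) (2 / 2 ^ R) 1 p q := by
            refine sum_le_sum fun v _ => mul_le_mul_of_nonneg_left ?_ (h0 _)
            refine le_trans (le_of_eq ?_) (sum_ballFlow_add_le hR hm v p q)
            exact (commodityEquiv m).symm.sum_comp
              (fun h => ballFlow R v h p q + ballFlow R v h q p)
        _ = _ := by rw [← sum_mul, h1, one_mul]

theorem cost_hubCapacity_le (hR : 0 < R) (hm : m = 6 * R) :
    (hubInstance m R).cost (hubCapacity m R) ≤ 5 * 2 ^ m := by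
  classical
  -- Cost times capacity, halved because each edge is counted as two ordered pairs.
  let w : HubNode m → HubNode m → ℝ := fun p q =>
    if (hubGraph m).Adj p q then hubWeight (1 / R) (R * (2 / 2 ^ R)) 0 p q / 2 else 0
  let K : Fin (Fintype.card (HubNode m)) → Fin (Fintype.card (HubNode m)) → ℝ := fun a b =>
    w ((nodeEquiv m).symm a) ((nodeEquiv m).symm b)
  have h1 : (hubInstance m R).cost (hubCapacity m R)
      = ∑ e : (hubInstance m R).G.edgeSet, edgeLoad K e := by
    unfold RobustInstance.cost
    convert sum_congr rfl fun e _ => ?_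
    obtain ⟨e, he⟩ := e
    induction e using Sym2.ind with
    | _ a b =>
      have hab : (hubGraph m).Adj ((nodeEquiv m).symm a) ((nodeEquiv m).symm b) := he
      simp only [edgeLoad_mk, K, w, hab, hab.symm, if_true]
      rw [hubWeight_comm _ _ _ ((nodeEquiv m).symm b), add_halves]
      change hubWeight 1 R 0 ((nodeEquiv m).symm a) ((nodeEquiv m).symm b) *
        hubWeight (1 / R) (2 / 2 ^ R) 1 ((nodeEquiv m).symm a) ((nodeEquiv m).symm b) = _
      rcases (nodeEquiv m).symm a with _ | a | a <;> rcases (nodeEquiv m).symm b with _ | b | b <;>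
        simp [hubWeight]
  have h2 : ∑ a, ∑ b, K a b = 2 ^ m * (m * (1 / R) / 2 + R * (2 / 2 ^ R)) := by
    rw [← sum_hubWeight]
    rw [(nodeEquiv m).symm.sum_comp (fun p => ∑ b, w p ((nodeEquiv m).symm b))]
    exact sum_congr rfl fun p _ => (nodeEquiv m).symm.sum_comp (fun q => w p q)
  rw [h1, sum_edgeLoad (K := K) _ fun a b hab => if_neg hab, h2, mul_comm]
  refine mul_le_mul_of_nonneg_right ?_ (by positivity)
  have hR' : (0 : ℝ) < R := by exact_mod_cast hR
  have h3 : (R : ℝ) ≤ 2 ^ R := by exact_mod_cast Nat.lt_two_pow_self.le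
  have h4 : (m : ℝ) * (1 / R) / 2 = 3 := by
    rw [hm]; push_cast; field_simp; norm_num
  have h5 : (R : ℝ) * (2 / 2 ^ R) ≤ 2 := by
    rw [← mul_div_assoc, div_le_iff₀ (by positivity)]
    linarith
  linarith

theorem two_pow_mul_le_linStat (hR : 2 * R ≤ m) : 2 ^ m * (R : ℝ) ≤ (hubInstance m R).linStat := by
  refine le_trans (le_of_eq ?_) ((hubInstance m R).le_linStat
    (statCapacities_hubInstance_nonempty hR)
    (fun h a => hubPotential R ((commodityEquiv m).symm h) ((nodeEquiv m).symm a)) ?_)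
  · change _ = ∑ h, (hubPotential R ((commodityEquiv m).symm h) ((nodeEquiv m).symm
      (nodeEquiv m none)) - hubPotential R ((commodityEquiv m).symm h) ((nodeEquiv m).symm
      (nodeEquiv m (some ((commodityEquiv m).symm h)))))
    simp only [Equiv.symm_apply_apply]
    rw [(commodityEquiv m).symm.sum_comp
      (fun h => hubPotential R h none - hubPotential R h (some h)), Fintype.sum_sum_type]
    simp [hubPotential]
  · rintro ⟨e, he⟩
    induction e using Sym2.ind with
    | _ a b =>
      obtain ⟨v, hv⟩ := hubPotential_sub_le R he
      refine ⟨_, ballDemand_mem_ballDemands R v, fun h x y hxy => ?_⟩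
      rcases Sym2.eq_iff.1 hxy with ⟨rfl, rfl⟩ | ⟨rfl, rfl⟩
      · exact (hv _).1
      · exact (hv _).2

/-- Every unit starting in the cube must cross a hub edge of cost `R`; `ψ` is the potential of this
cut. -/
theorem linDyn_hubInstance_pos (hR : 0 < R) (hm : m = 6 * R) : 0 < (hubInstance m R).linDyn := by
  have hR' : (0 : ℝ) < R := by exact_mod_cast hR
  let ψ : HubNode m → ℝ
    | some (.inl _) => 0
    | _ => R
  refine lt_of_lt_of_le ?_ ((hubInstance m R).le_linDyn
    ⟨_, hubCapacity_mem_dynCapacities hR hm⟩ (ballDemand_mem_ballDemands R ∅)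
    (fun _ a => ψ ((nodeEquiv m).symm a)) ?_)
  · change 0 < ∑ h, ballDemand R ∅ ((commodityEquiv m).symm h) * (ψ ((nodeEquiv m).symm
      (nodeEquiv m none)) - ψ ((nodeEquiv m).symm
      (nodeEquiv m (some ((commodityEquiv m).symm h)))))
    simp only [Equiv.symm_apply_apply]
    rw [(commodityEquiv m).symm.sum_comp
      (fun h => ballDemand R ∅ h * (ψ none - ψ (some h)))]
    refine sum_pos' (fun h _ => mul_nonneg (ballDemand_nonneg _ _ _) ?_) ⟨.inl ∅, mem_univ _, ?_⟩
    · rcases h with i | w <;> simp [ψ]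
    · simpa [ballDemand, ψ] using hR
  · intro _ a b hab
    replace hab : (hubGraph m).Adj ((nodeEquiv m).symm a) ((nodeEquiv m).symm b) := hab
    change ψ ((nodeEquiv m).symm b) - ψ ((nodeEquiv m).symm a)
      ≤ hubWeight 1 R 0 ((nodeEquiv m).symm a) ((nodeEquiv m).symm b)
    generalize (nodeEquiv m).symm a = p at hab ⊢
    generalize (nodeEquiv m).symm b = q at hab ⊢
    rcases p with _ | a | a <;> rcases q with _ | b | b <;>
      first | exact absurd hab id | simp [ψ, hubWeight]

end Instance

/-! ### The logarithmic gap. -/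

theorem theorem5 :
    ∃ c : ℝ, 0 < c ∧ ∀ N : ℕ, ∃ n : ℕ, N ≤ n ∧ ∃ I : RobustInstance n,
      I.dynCapacities.Nonempty ∧ I.statCapacities.Nonempty ∧
      0 < I.linDyn ∧ c * Real.log n ≤ I.linStat / I.linDyn := by
  -- The ratio is at least `R / 5` and `log n ≤ 8R`, whence `1 / 40`.
  refine ⟨1 / 40, by norm_num, fun N => ?_⟩
  let R := N + 1
  let m := 6 * R
  have hR : 0 < R := Nat.succ_pos N
  have hpos : 0 < (hubInstance m R).linDyn := linDyn_hubInstance_pos hR rfl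
  have hcard : Fintype.card (HubNode m) = 2 * 2 ^ m + 1 := by
    simp [two_mul]
  refine ⟨Fintype.card (HubNode m), ?_, hubInstance m R, ⟨_, hubCapacity_mem_dynCapacities hR rfl⟩,
    statCapacities_hubInstance_nonempty (by omega), hpos, ?_⟩
  · have : m < 2 ^ m := Nat.lt_two_pow_self
    omega
  have h1 : 2 ^ m * (R : ℝ) ≤ (hubInstance m R).linStat := two_pow_mul_le_linStat (by omega)
  have h2 : (hubInstance m R).linDyn ≤ 5 * 2 ^ m :=
    ((hubInstance m R).linDyn_le_cost (hubCapacity_mem_dynCapacities hR rfl)).trans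
      (cost_hubCapacity_le hR rfl)
  have hp : (0 : ℝ) < 2 ^ m := by positivity
  have hR1 : (1 : ℝ) ≤ R := by exact_mod_cast hR
  have h3 : Real.log (Fintype.card (HubNode m)) ≤ 8 * R := by
    have h4 : ((Fintype.card (HubNode m) : ℕ) : ℝ) ≤ 2 ^ (m + 2) := by
      rw [hcard]; push_cast
      have : (1 : ℝ) ≤ 2 ^ m := one_le_pow₀ (by norm_num)
      rw [pow_add]; linarith
    calc Real.log (Fintype.card (HubNode m)) ≤ Real.log (2 ^ (m + 2)) :=
          Real.log_le_log (by rw [hcard]; positivity) h4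
      _ = (m + 2) * Real.log 2 := by rw [Real.log_pow]; push_cast; ring
      _ ≤ (m + 2) * 1 := mul_le_mul_of_nonneg_left
          (by have := Real.log_two_lt_d9; linarith) (by positivity)
      _ ≤ 8 * R := by
          have : (m : ℝ) = 6 * R := by simp [m]
          linarith
  rw [le_div_iff₀ hpos]
  calc 1 / 40 * Real.log (Fintype.card (HubNode m)) * (hubInstance m R).linDyn
      ≤ (R / 5) * (5 * 2 ^ m) :=
        mul_le_mul (by linarith) h2 hpos.le (by positivity)
    _ = 2 ^ m * R := by ring
    _ ≤ _ := h1
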